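/- **Setting.** Formulae over a set $Var$ of propositional variables are $A ::= p \mid \top \mid \bot \mid \top^* \mid A\wedge A \mid A\to A \mid A * A \mid A \mathbin{-\!*} A$ ($p\in Var$). A *Kripke relational frame* is $(H,R,\epsilon)$ with $\epsilon\in H$ and $R\subseteq H^3$; a *Kripke relational model* adds $v:Var\to\mathcal P(H)$. Forcing: $h\Vdash p$ iff $h\in v(p)$; $\top,\bot,\wedge,\to$ are classical at each world; $h\Vdash\top^*$ iff $h=\epsilon$; $h\Vdash A*B$ iff there are $h_1,h_2$ with $R(h_1,h_2,h)$, $h_1\Vdash A$ and $h_2\Vdash B$; $h\Vdash A\mathbin{-\!*}B$ iff for all $h_1,h_2$ with $R(h_1,h,h_2)$ and $h_1\Vdash A$ we have $h_2\Vdash B$. A *frame axiom* is a closed first-order formula $$\forall x_1,\dots,x_m.\,(s_1=t_1\,\&\cdots\&\,s_p=t_p\,\&\,S_1\,\&\cdots\&\,S_k\Rightarrow\exists y_1,\dots,y_n.\,(T_1\,\&\cdots\&\,T_l))$$ ($m,n,p,k,l\ge 0$) where each $s_i,t_i$ is $\epsilon$ or some $x_j$; each $S_i$ is an inequality between such terms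 or a ternary atom $(u,v\triangleright w)$ with $u,v,w\in\{x_1,\dots,x_m\}$; each $x_j$ occurs at most once in $S_1,\dots,S_k$; and each $T_i$ is an equality, an inequality or a ternary atom over $\epsilon,x_1,\dots,x_m,y_1,\dots,y_n$. Its truth in a frame is first-order truth, $\triangleright$ being interpreted by $R$. *Labels* are the constant $\epsilon$ and countably many label variables. A *sequent* $\mathcal G;\Gamma\vdash\Delta$ consists of a finite set $\mathcal G$ of relational atoms $(x,y\triangleright z)$, $x=y$, $x\ne y$ between labels and finite sets $\Gamma,\Delta$ of labelled formulae $w:A$; the semicolon denotes union. $E(\mathcal G)\vdash x=y$ means that $(x,y)$ lies in the equivalence relation on labels generated by the equality atoms of $\mathcal G$. For a set $\mathcal{F}r$ of frame axioms, the cut-free rules of the corresponding instance of the general labelled calculus $LS_G$ are as follows (premises $\Longrightarrow$ conclusion): - $id$: $\mathcal G;\Gamma;w:p\vdash w':p;\Delta$ if $E(\mathcal G)\vdash w=w'$, for $p\in Var$. - $\bot L$: $\mathcal G;\Gamma;w:\bot\vdash\Delta$. $\top R$: $\mathcal G;\Gamma\vdash w:\top;\Delta$. - $\top^*L$: $\mathcal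 G;w=\epsilon;\Gamma\vdash\Delta\Longrightarrow\mathcal G;\Gamma;w:\top^*\vdash\Delta$. $\top^*R$: $\mathcal G;\Gamma\vdash w:\top^*;\Delta$ if $E(\mathcal G)\vdash w=\epsilon$. - $\wedge L$: $\mathcal G;\Gamma;w:A;w:B\vdash\Delta\Longrightarrow\mathcal G;\Gamma;w:A\wedge B\vdash\Delta$. $\wedge R$: $\mathcal G;\Gamma\vdash w:A;\Delta$ and $\mathcal G;\Gamma\vdash w:B;\Delta\Longrightarrow\mathcal G;\Gamma\vdash w:A\wedge B;\Delta$. - $\to L$: $\mathcal G;\Gamma\vdash w:A;\Delta$ and $\mathcal G;\Gamma;w:B\vdash\Delta\Longrightarrow\mathcal G;\Gamma;w:A\to B\vdash\Delta$. $\to R$: $\mathcal G;\Gamma;w:A\vdash w:B;\Delta\Longrightarrow\mathcal G;\Gamma\vdash w:A\to B;\Delta$. - $*L$: $\mathcal G;(x,y\triangleright z);\Gamma;x:A;y:B\vdash\Delta\Longrightarrow\mathcal G;\Gamma;z:A*B\vdash\Delta$, with $x,y$ distinct label variables not occurring in the conclusion. - $*R$: if $E(\mathcal G)\vdash z=z'$,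 then $\mathcal G;(x,y\triangleright z');\Gamma\vdash x:A;z:A*B;\Delta$ and $\mathcal G;(x,y\triangleright z');\Gamma\vdash y:B;z:A*B;\Delta\Longrightarrow\mathcal G;(x,y\triangleright z');\Gamma\vdash z:A*B;\Delta$. - $-\!*L$: if $E(\mathcal G)\vdash z=z'$, then $\mathcal G;(x,z'\triangleright y);\Gamma;z:A\mathbin{-\!*}B\vdash x:A;\Delta$ and $\mathcal G;(x,z'\triangleright y);\Gamma;z:A\mathbin{-\!*}B;y:B\vdash\Delta\Longrightarrow\mathcal G;(x,z'\triangleright y);\Gamma;z:A\mathbin{-\!*}B\vdash\Delta$. - $-\!*R$: $\mathcal G;(x,z\triangleright y);\Gamma;x:A\vdash y:B;\Delta\Longrightarrow\mathcal G;\Gamma\vdash z:A\mathbin{-\!*}B;\Delta$, with $x,y$ distinct label variables not occurring in the conclusion. - $NEq$: $\mathcal G;w\ne w';\Gamma\vdash\Delta$ if $E(\mathcal G)\vdash w=w'$. - $EM$: $\mathcal G;x=y;\Gamma\vdash\Delta$ and $\mathcal G;x\ne y;\Gamma\vdash\Delta\Longrightarrow\mathcal G;\Gamma\vdash\Delta$.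 - For each frame axiom in $\mathcal{F}r$, written as above, its structural rule. Let $\theta$ map $x_1,\dots,x_m$ to labels, and let $\sigma$ map $y_1,\dots,y_n$ to pairwise distinct label variables that do not occur in the conclusion and are not among the labels $x_i\theta$. If $E(\mathcal G)\vdash s_i\theta=t_i\theta$ for all $i\le p$, then $\mathcal G;S_1\theta;\dots;S_k\theta;T_1\theta\sigma;\dots;T_l\theta\sigma;\Gamma\vdash\Delta\Longrightarrow\mathcal G;S_1\theta;\dots;S_k\theta;\Gamma\vdash\Delta$. **Theorem.** Let $\mathcal{F}r$ be a finite set of frame axioms, $F$ a formula and $w\neq\epsilon$ a label. If the sequent $\vdash w:F$ has no cut-free derivation in the instance of $LS_G$ given by $\mathcal{F}r$, then there are a Kripke relational model $(H,R,\epsilon,v)$ whose frame satisfies every axiom in $\mathcal{F}r$ and a world $h\in H$ with $h\not\Vdash F$. -/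

import Mathlib

namespace LSG

/-- Formulae over a set `Var` of propositional variables. Negation and disjunction are the usual
classical abbreviations. -/
inductive Formula (Var : Type*) where
  | var (p : Var)
  | top
  | bot
  | emp
  | and (A B : Formula Var)
  | imp (A B : Formula Var)
  | star (A B : Formula Var)
  | wand (A B : Formula Var)
  deriving DecidableEq

/-! ### Terms, labels, relational atoms -/

/-- The constant `ε` or a variable from `V`. -/
inductive Term (V : Type*) where
  | eps
  | var (v : V)
  deriving DecidableEq

/-- Replace every variable by a term; the constant `ε` is left alone. -/
def Term.subst {V W : Type*} (θ : V → Term W) : Term V → Term W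
  | .eps => .eps
  | .var v => θ v

/-- The list of variable occurrences (of length 0 or 1). -/
def Term.vars {V : Type*} : Term V → List V
  | .eps => []
  | .var v => [v]

/-- Relational atoms: `rel x y z` is the ternary atom `(x, y ▷ z)`, `eq x y` is `x = y` and
`neq x y` is `x ≠ y`. -/
inductive Atom (V : Type*) where
  | rel (x y z : Term V)
  | eq (x y : Term V)
  | neq (x y : Term V)
  deriving DecidableEq

def Atom.subst {V W : Type*} (θ : V → Term W) : Atom V → Atom W
  | .rel x y z => .rel (x.subst θ) (y.subst θ) (z.subst θ)
  | .eq x y => .eq (x.subst θ) (y.subst θ)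
  | .neq x y => .neq (x.subst θ) (y.subst θ)

/-- The list of variable occurrences of an atom, with repetitions. -/
def Atom.vars {V : Type*} : Atom V → List V
  | .rel x y z => x.vars ++ y.vars ++ z.vars
  | .eq x y => x.vars ++ y.vars
  | .neq x y => x.vars ++ y.vars

/-- Labels: the constant `ε` and countably many label variables. -/
abbrev Label := Term ℕ

/-! ### Frame axioms -/

/-- The atoms allowed in the antecedent of a frame axiom besides its equations: inequalities, and
ternary atoms in which `ε` does not occur. -/
def Atom.IsAntecedent {V : Type*} : Atom V → Prop
  | .rel x y z => x ≠ .eps ∧ y ≠ .eps ∧ z ≠ .eps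
  | .eq _ _ => False
  | .neq _ _ => True

/-- A frame axiom
`∀ x₁ … x_m, (s₁ = t₁ & … & s_p = t_p & S₁ & … & S_k ⇒ ∃ y₁ … y_n, (T₁ & … & T_l))`.
The `x`s are indexed by `Fin m` and the `y`s by `Fin n`. -/
structure FrameAxiom where
  m : ℕ
  n : ℕ
  /-- the pairs `(s_i, t_i)` -/
  eqs : List (Term (Fin m) × Term (Fin m))
  /-- the atoms `S_i` -/
  ante : List (Atom (Fin m))
  /-- the atoms `T_i` -/
  concl : List (Atom (Fin m ⊕ Fin n))
  ante_form : ∀ S ∈ ante, S.IsAntecedent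
  /-- each variable occurs at most once in `S₁, …, S_k` -/
  ante_linear : (ante.flatMap Atom.vars).Nodup

/-! ### Kripke relational semantics -/

/-- A Kripke relational frame `(H, R, ε)`. -/
structure KripkeFrame where
  World : Type*
  R : World → World → World → Prop
  unit : World

def Term.eval {V : Type*} (K : KripkeFrame) (μ : V → K.World) : Term V → K.World
  | .eps => K.unit
  | .var v => μ v

def Atom.Holds {V : Type*} (K : KripkeFrame) (μ : V → K.World) : Atom V → Prop
  | .rel x y z => K.R (x.eval K μ) (y.eval K μ) (z.eval K μ)
  | .eq x y => x.eval K μ = y.eval K μ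
  | .neq x y => x.eval K μ ≠ y.eval K μ

/-- First-order truth of a frame axiom in a Kripke relational frame. -/
def KripkeFrame.Satisfies (K : KripkeFrame) (ax : FrameAxiom) : Prop :=
  ∀ μ : Fin ax.m → K.World,
    (∀ e ∈ ax.eqs, e.1.eval K μ = e.2.eval K μ) →
    (∀ S ∈ ax.ante, S.Holds K μ) →
    ∃ ν : Fin ax.n → K.World, ∀ T ∈ ax.concl, T.Holds K (Sum.elim μ ν)

/-- A Kripke relational model: a frame with a valuation. -/
structure KripkeModel (Var : Type*) extends KripkeFrame where
  val : Var → Set World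

/-- The forcing relation between worlds and formulae. -/
def KripkeModel.Forces {Var : Type*} (M : KripkeModel Var) : M.World → Formula Var → Prop
  | h, .var p => h ∈ M.val p
  | _, .top => True
  | _, .bot => False
  | h, .emp => h = M.unit
  | h, .and A B => M.Forces h A ∧ M.Forces h B
  | h, .imp A B => M.Forces h A → M.Forces h B
  | h, .star A B => ∃ h₁ h₂, M.R h₁ h₂ h ∧ M.Forces h₁ A ∧ M.Forces h₂ B
  | h, .wand A B => ∀ h₁ h₂, M.R h₁ h h₂ → M.Forces h₁ A → M.Forces h₂ B

/-! ### The labelled sequent calculus -/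

/-- A labelled sequent `G; Γ ⊢ Δ`, made of a finite set `G` of relational atoms and finite sets
`Γ`, `Δ` of labelled formulae `w : A`. -/
structure Sequent (Var : Type*) where
  G : Finset (Atom ℕ)
  Γ : Finset (Label × Formula Var)
  Δ : Finset (Label × Formula Var)

/-- The label variable `a` does not occur in the sequent. -/
def Sequent.Fresh {Var : Type*} (s : Sequent Var) (a : ℕ) : Prop :=
  (∀ r ∈ s.G, a ∉ r.vars) ∧ (∀ f ∈ s.Γ, f.1 ≠ .var a) ∧ (∀ f ∈ s.Δ, f.1 ≠ .var a)

/-- The judgment `E(G) ⊢ a = b`: the equation follows from the equality atoms of `G` by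
reflexivity, symmetry and transitivity. -/
def EqJudgment (G : Finset (Atom ℕ)) : Label → Label → Prop :=
  Relation.EqvGen fun a b => Atom.eq a b ∈ G

/-- Cut-free derivability in the instance of the general labelled calculus given by the set `Fr`
of frame axioms: the rules of the base calculus without cut, and for each frame axiom the
structural rule synthesised from it. Since sequents are made of sets, the `Γ` of `insert f Γ` may
contain `f` itself. -/
inductive CutFreeDerivable {Var : Type*} [DecidableEq Var] (Fr : Set FrameAxiom) :
    Sequent Var → Prop
  | id {G Γ Δ} (w w' : Label) (p : Var) :
      EqJudgment G w w' →
      CutFreeDerivable Fr ⟨G, insert (w, .var p) Γ, insert (w', .var p) Δ⟩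
  | botL {G Γ Δ} (w : Label) :
      CutFreeDerivable Fr ⟨G, insert (w, .bot) Γ, Δ⟩
  | topR {G Γ Δ} (w : Label) :
      CutFreeDerivable Fr ⟨G, Γ, insert (w, .top) Δ⟩
  | empL {G Γ Δ} (w : Label) :
      CutFreeDerivable Fr ⟨insert (.eq w .eps) G, Γ, Δ⟩ →
      CutFreeDerivable Fr ⟨G, insert (w, .emp) Γ, Δ⟩
  | empR {G Γ Δ} (w : Label) :
      EqJudgment G w .eps →
      CutFreeDerivable Fr ⟨G, Γ, insert (w, .emp) Δ⟩
  | andL {G Γ Δ} (w : Label) (A B : Formula Var) :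
      CutFreeDerivable Fr ⟨G, insert (w, A) (insert (w, B) Γ), Δ⟩ →
      CutFreeDerivable Fr ⟨G, insert (w, .and A B) Γ, Δ⟩
  | andR {G Γ Δ} (w : Label) (A B : Formula Var) :
      CutFreeDerivable Fr ⟨G, Γ, insert (w, A) Δ⟩ →
      CutFreeDerivable Fr ⟨G, Γ, insert (w, B) Δ⟩ →
      CutFreeDerivable Fr ⟨G, Γ, insert (w, .and A B) Δ⟩
  | impL {G Γ Δ} (w : Label) (A B : Formula Var) :
      CutFreeDerivable Fr ⟨G, Γ, insert (w, A) Δ⟩ →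
      CutFreeDerivable Fr ⟨G, insert (w, B) Γ, Δ⟩ →
      CutFreeDerivable Fr ⟨G, insert (w, .imp A B) Γ, Δ⟩
  | impR {G Γ Δ} (w : Label) (A B : Formula Var) :
      CutFreeDerivable Fr ⟨G, insert (w, A) Γ, insert (w, B) Δ⟩ →
      CutFreeDerivable Fr ⟨G, Γ, insert (w, .imp A B) Δ⟩
  /- `x` and `y` are distinct label variables that do not occur in the conclusion. -/
  | starL {G Γ Δ} (z : Label) (A B : Formula Var) (x y : ℕ) :
      x ≠ y →
      Sequent.Fresh ⟨G, insert (z, .star A B) Γ, Δ⟩ x →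
      Sequent.Fresh ⟨G, insert (z, .star A B) Γ, Δ⟩ y →
      CutFreeDerivable Fr
        ⟨insert (.rel (.var x) (.var y) z) G, insert (.var x, A) (insert (.var y, B) Γ), Δ⟩ →
      CutFreeDerivable Fr ⟨G, insert (z, .star A B) Γ, Δ⟩
  | starR {G Γ Δ} (x y z z' : Label) (A B : Formula Var) :
      EqJudgment G z z' →
      CutFreeDerivable Fr
        ⟨insert (.rel x y z') G, Γ, insert (x, A) (insert (z, .star A B) Δ)⟩ →
      CutFreeDerivable Fr
        ⟨insert (.rel x y z') G, Γ, insert (y, B) (insert (z, .star A B) Δ)⟩ →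
      CutFreeDerivable Fr ⟨insert (.rel x y z') G, Γ, insert (z, .star A B) Δ⟩
  | wandL {G Γ Δ} (x y z z' : Label) (A B : Formula Var) :
      EqJudgment G z z' →
      CutFreeDerivable Fr
        ⟨insert (.rel x z' y) G, insert (z, .wand A B) Γ, insert (x, A) Δ⟩ →
      CutFreeDerivable Fr
        ⟨insert (.rel x z' y) G, insert (y, B) (insert (z, .wand A B) Γ), Δ⟩ →
      CutFreeDerivable Fr ⟨insert (.rel x z' y) G, insert (z, .wand A B) Γ, Δ⟩
  /- `x` and `y` are distinct label variables that do not occur in the conclusion. -/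
  | wandR {G Γ Δ} (z : Label) (A B : Formula Var) (x y : ℕ) :
      x ≠ y →
      Sequent.Fresh ⟨G, Γ, insert (z, .wand A B) Δ⟩ x →
      Sequent.Fresh ⟨G, Γ, insert (z, .wand A B) Δ⟩ y →
      CutFreeDerivable Fr
        ⟨insert (.rel (.var x) z (.var y)) G, insert (.var x, A) Γ, insert (.var y, B) Δ⟩ →
      CutFreeDerivable Fr ⟨G, Γ, insert (z, .wand A B) Δ⟩
  | nEq {G Γ Δ} (w w' : Label) :
      EqJudgment G w w' →
      CutFreeDerivable Fr ⟨insert (.neq w w') G, Γ, Δ⟩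
  | em {G Γ Δ} (x y : Label) :
      CutFreeDerivable Fr ⟨insert (.eq x y) G, Γ, Δ⟩ →
      CutFreeDerivable Fr ⟨insert (.neq x y) G, Γ, Δ⟩ →
      CutFreeDerivable Fr ⟨G, Γ, Δ⟩
  /- The rule synthesised from the frame axiom `ax`. Here `θ` instantiates the universal variables
  by labels and `σ` the existential ones by pairwise distinct label variables that neither occur
  in the conclusion nor instantiate a universal variable. -/
  | struct {G Γ Δ} (ax : FrameAxiom) (θ : Fin ax.m → Label) (σ : Fin ax.n → ℕ) :
      ax ∈ Fr →
      Function.Injective σ →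
      (∀ j, Sequent.Fresh ⟨G ∪ (ax.ante.map (Atom.subst θ)).toFinset, Γ, Δ⟩ (σ j)) →
      (∀ i j, θ i ≠ .var (σ j)) →
      (∀ e ∈ ax.eqs, EqJudgment G (e.1.subst θ) (e.2.subst θ)) →
      CutFreeDerivable Fr
        ⟨G ∪ (ax.ante.map (Atom.subst θ)).toFinset ∪
          (ax.concl.map (Atom.subst (Sum.elim θ fun j => .var (σ j)))).toFinset, Γ, Δ⟩ →
      CutFreeDerivable Fr ⟨G ∪ (ax.ante.map (Atom.subst θ)).toFinset, Γ, Δ⟩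

end LSG

/-!
Read a derivation backwards: an underivable conclusion of a rule always has an underivable premise.
Since a sequent is finite and there are only countably many labels, frame axioms and subformulae of
the given formulae, the Rasiowa–Sikorski lemma yields an increasing chain of underivable sequents
that performs every backward step which stays possible along the chain. The union of such a chain
is closed under all rules, and the labels modulo its equality atoms form a countermodel.

A frame axiom has to be checked on equivalence classes of labels, whereas its structural rule needs
an instance of the atoms `S_i` that occurs literally. As no variable occurs twice in the `S_i`,
representatives of the classes can be chosen for each `S_i` separately; the equations
`s_i = t_i` need no such choice because the rule only tests them modulo `E(G)`.
-/

namespace LSG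

open Filter

/-! ### Substitution, countability and subformulae -/

theorem Term.subst_var {V : Type*} (t : Term V) : t.subst .var = t := by
  cases t <;> rfl

theorem Atom.subst_var {V : Type*} (T : Atom V) : T.subst .var = T := by
  cases T <;> simp only [Atom.subst, Term.subst_var]

theorem Term.subst_congr {V W : Type*} {θ η : V → Term W} (t : Term V)
    (h : ∀ v ∈ t.vars, θ v = η v) : t.subst θ = t.subst η := by
  cases t with
  | eps => rfl
  | var v => exact h v (List.mem_singleton_self v)

theorem Atom.subst_congr {V W : Type*} {θ η : V → Term W} (T : Atom V)
    (h : ∀ v ∈ T.vars, θ v = η v) : T.subst θ = T.subst η := by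
  cases T <;> simp only [Atom.vars, List.mem_append] at h <;> simp only [Atom.subst] <;>
    congr 1 <;> exact Term.subst_congr _ fun v hv => h v (by simp [hv])

instance {V : Type*} [Countable V] : Countable (Term V) :=
  Function.Surjective.countable (f := fun o : Option V => o.elim .eps .var) fun
    | .eps => ⟨none, rfl⟩
    | .var v => ⟨some v, rfl⟩

instance {V : Type*} [Countable V] : Countable (Atom V) :=
  Function.Surjective.countable
    (f := Sum.elim (fun p : Term V × Term V × Term V => .rel p.1 p.2.1 p.2.2)
      (Sum.elim (fun p : Term V × Term V => .eq p.1 p.2)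
        fun p : Term V × Term V => .neq p.1 p.2)) fun
    | .rel x y z => ⟨.inl (x, y, z), rfl⟩
    | .eq x y => ⟨.inr (.inl (x, y)), rfl⟩
    | .neq x y => ⟨.inr (.inr (x, y)), rfl⟩

instance : Countable FrameAxiom :=
  Function.Injective.countable
    (f := fun ax => (⟨ax.m, ax.n, ax.eqs, ax.ante, ax.concl⟩ :
      Σ m n : ℕ, List (Term (Fin m) × Term (Fin m)) × List (Atom (Fin m)) ×
        List (Atom (Fin m ⊕ Fin n)))) <| by
    rintro ⟨⟩ ⟨⟩ h
    cases h
    rfl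

variable {Var : Type*}

/-- The subformulae of a formula, the formula itself included. -/
def Formula.subformulas : Formula Var → Set (Formula Var)
  | .and A B => insert (.and A B) (A.subformulas ∪ B.subformulas)
  | .imp A B => insert (.imp A B) (A.subformulas ∪ B.subformulas)
  | .star A B => insert (.star A B) (A.subformulas ∪ B.subformulas)
  | .wand A B => insert (.wand A B) (A.subformulas ∪ B.subformulas)
  | A => {A}

theorem Formula.self_mem_subformulas (A : Formula Var) : A ∈ A.subformulas := by
  cases A <;> simp [subformulas]

theorem Formula.finite_subformulas (A : Formula Var) : A.subformulas.Finite := by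
  induction A <;> simp [subformulas, *]

/-- A set of formulae containing the immediate subformulae of its members. -/
structure SubformulaClosed (S : Set (Formula Var)) : Prop where
  and {A B} : .and A B ∈ S → A ∈ S ∧ B ∈ S
  imp {A B} : .imp A B ∈ S → A ∈ S ∧ B ∈ S
  star {A B} : .star A B ∈ S → A ∈ S ∧ B ∈ S
  wand {A B} : .wand A B ∈ S → A ∈ S ∧ B ∈ S

theorem Formula.subformulaClosed_subformulas (A : Formula Var) :
    SubformulaClosed A.subformulas := by
  have self := Formula.self_mem_subformulas (Var := Var)
  constructor <;> intro C D h <;> induction A <;> simp_all [subformulas] <;> grind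

theorem exists_countable_subformulaClosed {T : Set (Formula Var)} (hT : T.Countable) :
    ∃ S : Set (Formula Var), T ⊆ S ∧ S.Countable ∧ SubformulaClosed S := by
  refine ⟨⋃ A ∈ T, A.subformulas,
    fun A hA => Set.mem_biUnion hA A.self_mem_subformulas,
    hT.biUnion fun A _ => A.finite_subformulas.countable, ?_⟩
  constructor <;> simp only [Set.mem_iUnion₂] <;> rintro A B ⟨C, hC, h⟩
  · exact (C.subformulaClosed_subformulas.and h).imp (fun hA => ⟨C, hC, hA⟩) fun hB => ⟨C, hC, hB⟩
  · exact (C.subformulaClosed_subformulas.imp h).imp (fun hA => ⟨C, hC, hA⟩) fun hB => ⟨C, hC, hB⟩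
  · exact (C.subformulaClosed_subformulas.star h).imp (fun hA => ⟨C, hC, hA⟩) fun hB => ⟨C, hC, hB⟩
  · exact (C.subformulaClosed_subformulas.wand h).imp (fun hA => ⟨C, hC, hA⟩) fun hB => ⟨C, hC, hB⟩

/-! ### Hintikka sequents and their canonical models -/

/-- A labelled sequent with possibly infinite components. -/
structure LimitSequent (Var : Type*) where
  G : Set (Atom ℕ)
  Γ : Set (Label × Formula Var)
  Δ : Set (Label × Formula Var)

namespace LimitSequent

/-- The judgment `E(G) ⊢ a = b` for the infinite set `G` of relational atoms of `L`. -/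
def LabelEq (L : LimitSequent Var) : Label → Label → Prop :=
  Relation.EqvGen fun a b => .eq a b ∈ L.G

/-- A limit sequent closed under backward application of the rules given by `Fr`: no zero-premise
rule applies to it, and it contains some premise of every other rule that does. -/
structure IsHintikka (Fr : Set FrameAxiom) (L : LimitSequent Var) : Prop where
  id {w w' p} : (w, .var p) ∈ L.Γ → (w', .var p) ∈ L.Δ → ¬ L.LabelEq w w'
  botL {w} : (w, .bot) ∉ L.Γ
  topR {w} : (w, .top) ∉ L.Δ
  empL {w} : (w, .emp) ∈ L.Γ → .eq w .eps ∈ L.G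
  empR {w} : (w, .emp) ∈ L.Δ → ¬ L.LabelEq w .eps
  andL {w A B} : (w, .and A B) ∈ L.Γ → (w, A) ∈ L.Γ ∧ (w, B) ∈ L.Γ
  andR {w A B} : (w, .and A B) ∈ L.Δ → (w, A) ∈ L.Δ ∨ (w, B) ∈ L.Δ
  impL {w A B} : (w, .imp A B) ∈ L.Γ → (w, A) ∈ L.Δ ∨ (w, B) ∈ L.Γ
  impR {w A B} : (w, .imp A B) ∈ L.Δ → (w, A) ∈ L.Γ ∧ (w, B) ∈ L.Δ
  starL {z A B} : (z, .star A B) ∈ L.Γ →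
    ∃ x y, .rel x y z ∈ L.G ∧ (x, A) ∈ L.Γ ∧ (y, B) ∈ L.Γ
  starR {x y z z' A B} : (z, .star A B) ∈ L.Δ → .rel x y z' ∈ L.G → L.LabelEq z z' →
    (x, A) ∈ L.Δ ∨ (y, B) ∈ L.Δ
  wandL {x y z z' A B} : (z, .wand A B) ∈ L.Γ → .rel x z' y ∈ L.G → L.LabelEq z z' →
    (x, A) ∈ L.Δ ∨ (y, B) ∈ L.Γ
  wandR {z A B} : (z, .wand A B) ∈ L.Δ →
    ∃ x y, .rel x z y ∈ L.G ∧ (x, A) ∈ L.Γ ∧ (y, B) ∈ L.Δ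
  nEq {w w'} : .neq w w' ∈ L.G → ¬ L.LabelEq w w'
  em (x y) : .eq x y ∈ L.G ∨ .neq x y ∈ L.G
  struct {ax} {θ : Fin ax.m → Label} : ax ∈ Fr → (∀ S ∈ ax.ante, S.subst θ ∈ L.G) →
    (∀ e ∈ ax.eqs, L.LabelEq (e.1.subst θ) (e.2.subst θ)) →
    ∃ τ : Fin ax.n → Label, ∀ T ∈ ax.concl, T.subst (Sum.elim θ τ) ∈ L.G

variable {L : LimitSequent Var} {V : Type*}

/-- The labels modulo `LabelEq`, with the relation and the valuation read off from `L`. -/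
def canonicalModel (L : LimitSequent Var) : KripkeModel Var where
  World := Quot L.LabelEq
  R a b c := ∃ x y z, .rel x y z ∈ L.G ∧ Quot.mk _ x = a ∧ Quot.mk _ y = b ∧ Quot.mk _ z = c
  unit := Quot.mk _ .eps
  val p := Quot.mk _ '' {x | (x, .var p) ∈ L.Γ}

/-- The world of the canonical model denoted by a label. -/
def world (L : LimitSequent Var) (x : Label) : L.canonicalModel.World :=
  Quot.mk _ x

theorem world_eq_iff {x y : Label} : L.world x = L.world y ↔ L.LabelEq x y :=
  (Relation.EqvGen.is_equivalence _).quot_mk_eq_iff x y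

theorem exists_lift_world (μ : V → L.canonicalModel.World) :
    ∃ θ : V → Label, L.world ∘ θ = μ :=
  (Quot.mk_surjective (r := L.LabelEq)).comp_left μ

theorem eval_world_comp (θ : V → Label) (t : Term V) :
    t.eval L.canonicalModel.toKripkeFrame (L.world ∘ θ) = L.world (t.subst θ) := by
  cases t <;> rfl

namespace IsHintikka

variable {Fr : Set FrameAxiom}

theorem forces_and_not_forces (hL : L.IsHintikka Fr) (A : Formula Var) (w : Label) :
    ((w, A) ∈ L.Γ → L.canonicalModel.Forces (L.world w) A) ∧
      ((w, A) ∈ L.Δ → ¬ L.canonicalModel.Forces (L.world w) A) := by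
  induction A generalizing w with
  | var p =>
    refine ⟨fun h => ⟨w, h, rfl⟩, ?_⟩
    rintro h ⟨x, hx, hxw⟩
    exact hL.id hx h (world_eq_iff.1 hxw)
  | top => exact ⟨fun _ => trivial, fun h => (hL.topR h).elim⟩
  | bot => exact ⟨fun h => (hL.botL h).elim, fun _ hf => hf⟩
  | emp =>
    exact ⟨fun h => world_eq_iff.2 (.rel _ _ (hL.empL h)),
      fun h hf => hL.empR h (world_eq_iff.1 hf)⟩
  | and A B ihA ihB =>
    refine ⟨fun h => ⟨(ihA w).1 (hL.andL h).1, (ihB w).1 (hL.andL h).2⟩, ?_⟩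
    rintro h ⟨hfA, hfB⟩
    exact (hL.andR h).elim (fun hA => (ihA w).2 hA hfA) fun hB => (ihB w).2 hB hfB
  | imp A B ihA ihB =>
    refine ⟨fun h hf => ?_, fun h hf => ?_⟩
    · exact (hL.impL h).elim (fun hA => ((ihA w).2 hA hf).elim) (ihB w).1
    · exact (ihB w).2 (hL.impR h).2 (hf ((ihA w).1 (hL.impR h).1))
  | star A B ihA ihB =>
    constructor
    · intro h
      obtain ⟨x, y, hR, hA, hB⟩ := hL.starL h
      exact ⟨_, _, ⟨x, y, w, hR, rfl, rfl, rfl⟩, (ihA x).1 hA, (ihB y).1 hB⟩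
    · rintro h ⟨_, _, ⟨x, y, z, hR, rfl, rfl, hz⟩, hfA, hfB⟩
      exact (hL.starR h hR (world_eq_iff.1 hz.symm)).elim (fun hA => (ihA x).2 hA hfA)
        fun hB => (ihB y).2 hB hfB
  | wand A B ihA ihB =>
    constructor
    · rintro h _ _ ⟨x, z, y, hR, rfl, hz, rfl⟩ hfA
      exact (hL.wandL h hR (world_eq_iff.1 hz.symm)).elim (fun hA => ((ihA x).2 hA hfA).elim)
        (ihB y).1
    · intro h hf
      obtain ⟨x, y, hR, hA, hB⟩ := hL.wandR h
      exact (ihB y).2 hB (hf _ _ ⟨x, w, y, hR, rfl, rfl, rfl⟩ ((ihA x).1 hA))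

theorem holds_of_subst_mem (hL : L.IsHintikka Fr) (θ : V → Label) {T : Atom V}
    (hT : T.subst θ ∈ L.G) : T.Holds L.canonicalModel.toKripkeFrame (L.world ∘ θ) := by
  cases T <;> simp only [Atom.Holds, eval_world_comp]
  case rel => exact ⟨_, _, _, hT, rfl, rfl, rfl⟩
  case eq => exact world_eq_iff.2 (.rel _ _ hT)
  case neq => exact fun h => hL.nEq hT (world_eq_iff.1 h)

theorem exists_subst_mem_of_holds (hL : L.IsHintikka Fr) {μ : V → L.canonicalModel.World}
    {T : Atom V} (hform : T.IsAntecedent) (hlin : T.vars.Nodup)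
    (hT : T.Holds L.canonicalModel.toKripkeFrame μ) :
    ∃ θ : V → Label, L.world ∘ θ = μ ∧ T.subst θ ∈ L.G := by
  classical
  obtain ⟨θ, rfl⟩ := exists_lift_world μ
  match T, hform with
  | .neq x y, _ =>
    simp only [Atom.Holds, eval_world_comp, ne_eq, world_eq_iff] at hT
    exact ⟨θ, rfl, (hL.em _ _).resolve_left fun h => hT (.rel _ _ h)⟩
  | .rel (.var a) (.var b) (.var c), _ =>
    obtain ⟨x, y, z, hr, hx, hy, hz⟩ := hT
    obtain ⟨⟨hab, hac⟩, hbc⟩ : (a ≠ b ∧ a ≠ c) ∧ b ≠ c := by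
      simpa [Atom.vars, Term.vars] using hlin
    refine ⟨Function.update (Function.update (Function.update θ a x) b y) c z, ?_, ?_⟩
    · change L.world x = (L.world ∘ θ) a at hx
      change L.world y = (L.world ∘ θ) b at hy
      change L.world z = (L.world ∘ θ) c at hz
      simp only [Function.comp_update, hx, hy, hz, Function.update_eq_self]
    · simpa [Atom.subst, Term.subst, hab, hac, hbc] using hr

theorem exists_forall_subst_mem_of_holds (hL : L.IsHintikka Fr)
    {μ : V → L.canonicalModel.World} {l : List (Atom V)}
    (hform : ∀ S ∈ l, S.IsAntecedent) (hlin : (l.flatMap Atom.vars).Nodup)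
    (hl : ∀ S ∈ l, S.Holds L.canonicalModel.toKripkeFrame μ) :
    ∃ θ : V → Label, L.world ∘ θ = μ ∧ ∀ S ∈ l, S.subst θ ∈ L.G := by
  classical
  induction l with
  | nil => simpa using exists_lift_world μ
  | cons S l ih =>
    rw [List.flatMap_cons, List.nodup_append'] at hlin
    obtain ⟨hlinS, hlinl, hdisj⟩ := hlin
    rw [List.forall_mem_cons] at hform hl
    obtain ⟨θ, hθ, hθl⟩ := ih hform.2 hlinl hl.2
    obtain ⟨η, hη, hηS⟩ := hL.exists_subst_mem_of_holds hform.1 hlinS hl.1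
    refine ⟨fun v => if v ∈ S.vars then η v else θ v, funext fun v => ?_,
      List.forall_mem_cons.2 ⟨?_, fun T hT => ?_⟩⟩
    · by_cases hv : v ∈ S.vars
      · simp only [Function.comp_apply, if_pos hv, ← hη]
      · simp only [Function.comp_apply, if_neg hv, ← hθ]
    · rwa [S.subst_congr fun v hv => if_pos hv]
    · rw [T.subst_congr fun v hv => if_neg fun hv' => hdisj hv' (List.mem_flatMap.2 ⟨T, hT, hv⟩)]
      exact hθl T hT

theorem satisfies (hL : L.IsHintikka Fr) {ax : FrameAxiom} (hax : ax ∈ Fr) :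
    L.canonicalModel.toKripkeFrame.Satisfies ax := by
  intro μ heqs hante
  obtain ⟨θ, rfl, hθ⟩ := hL.exists_forall_subst_mem_of_holds ax.ante_form ax.ante_linear hante
  simp only [eval_world_comp, world_eq_iff] at heqs
  obtain ⟨τ, hτ⟩ := hL.struct hax hθ heqs
  refine ⟨L.world ∘ τ, fun T hT => ?_⟩
  rw [← Sum.comp_elim]
  exact hL.holds_of_subst_mem _ (hτ T hT)

end IsHintikka
end LimitSequent


/-! ### Fresh label variables -/

theorem Term.eventually_notMem_vars (t : Label) : ∀ᶠ a in atTop, a ∉ t.vars := by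
  cases t with
  | eps => simp [Term.vars]
  | var v => simpa [Term.vars] using eventually_ne_atTop v

theorem Atom.eventually_notMem_vars (r : Atom ℕ) : ∀ᶠ a in atTop, a ∉ r.vars := by
  cases r <;> simp only [Atom.vars, List.mem_append, not_or, eventually_and,
    Term.eventually_notMem_vars, and_self]

theorem Term.eventually_ne_var (t : Label) : ∀ᶠ a in atTop, t ≠ .var a := by
  filter_upwards [t.eventually_notMem_vars] with a ha
  rintro rfl
  exact ha (List.mem_singleton_self a)

theorem Sequent.eventually_fresh (s : Sequent Var) : ∀ᶠ a in atTop, s.Fresh a :=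
  ((eventually_all_finset s.G).2 fun r _ => r.eventually_notMem_vars).and
    (((eventually_all_finset s.Γ).2 fun f _ => f.1.eventually_ne_var).and
      ((eventually_all_finset s.Δ).2 fun f _ => f.1.eventually_ne_var))

theorem Sequent.exists_fresh_pair (s : Sequent Var) : ∃ x y, x ≠ y ∧ s.Fresh x ∧ s.Fresh y := by
  obtain ⟨N, hN⟩ := eventually_atTop.1 s.eventually_fresh
  exact ⟨N, N + 1, N.lt_succ_self.ne, hN _ le_rfl, hN _ N.le_succ⟩

theorem Sequent.exists_fresh_injective (s : Sequent Var) {ι : Type*} [Finite ι] (θ : ι → Label)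
    (n : ℕ) : ∃ σ : Fin n → ℕ, σ.Injective ∧ (∀ j, s.Fresh (σ j)) ∧ ∀ i j, θ i ≠ .var (σ j) := by
  obtain ⟨N, hN⟩ := eventually_atTop.1
    (s.eventually_fresh.and (eventually_all.2 fun i => (θ i).eventually_ne_var))
  exact ⟨fun j => N + j, fun i j h => Fin.ext (Nat.add_left_cancel h),
    fun j => (hN _ (N.le_add_right j)).1, fun i j => (hN _ (N.le_add_right j)).2 i⟩

/-! ### Extending underivable sequents -/

instance : Preorder (Sequent Var) :=
  Preorder.lift fun s => (s.G, s.Γ, s.Δ)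

theorem Sequent.le_def {s t : Sequent Var} : s ≤ t ↔ s.G ⊆ t.G ∧ s.Γ ⊆ t.Γ ∧ s.Δ ⊆ t.Δ :=
  Iff.rfl

variable [DecidableEq Var] {Fr : Set FrameAxiom}

/-- The sequents without a cut-free derivation from `Fr`, ordered by componentwise inclusion. -/
abbrev UnderivableSequent (Var : Type*) [DecidableEq Var] (Fr : Set FrameAxiom) : Type _ :=
  {s : Sequent Var // ¬ CutFreeDerivable Fr s}

namespace UnderivableSequent

variable {s : UnderivableSequent Var Fr} {w w' x y z z' : Label} {A B : Formula Var} {p : Var}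

theorem not_eqJudgment_of_var (hΓ : (w, .var p) ∈ s.1.Γ) (hΔ : (w', .var p) ∈ s.1.Δ) :
    ¬ EqJudgment s.1.G w w' := fun h =>
  s.2 <| by simpa only [Finset.insert_eq_of_mem, hΓ, hΔ] using
    CutFreeDerivable.id (Γ := s.1.Γ) (Δ := s.1.Δ) w w' p h

theorem bot_notMem : (w, .bot) ∉ s.1.Γ := fun h =>
  s.2 <| by simpa only [Finset.insert_eq_of_mem, h] using
    CutFreeDerivable.botL (G := s.1.G) (Γ := s.1.Γ) (Δ := s.1.Δ) w

theorem top_notMem : (w, .top) ∉ s.1.Δ := fun h =>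
  s.2 <| by simpa only [Finset.insert_eq_of_mem, h] using
    CutFreeDerivable.topR (G := s.1.G) (Γ := s.1.Γ) (Δ := s.1.Δ) w

theorem not_eqJudgment_eps (hΔ : (w, .emp) ∈ s.1.Δ) : ¬ EqJudgment s.1.G w .eps := fun h =>
  s.2 <| by simpa only [Finset.insert_eq_of_mem, hΔ] using
    CutFreeDerivable.empR (Γ := s.1.Γ) (Δ := s.1.Δ) w h

theorem not_eqJudgment_of_neq (hG : .neq w w' ∈ s.1.G) : ¬ EqJudgment s.1.G w w' := fun h =>
  s.2 <| by simpa only [Finset.insert_eq_of_mem, hG] using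
    CutFreeDerivable.nEq (Γ := s.1.Γ) (Δ := s.1.Δ) w w' h

theorem exists_ge_empL (hΓ : (w, .emp) ∈ s.1.Γ) : ∃ t ≥ s, .eq w .eps ∈ t.1.G := by
  refine ⟨⟨⟨insert (.eq w .eps) s.1.G, s.1.Γ, s.1.Δ⟩, fun h => s.2 ?_⟩,
    Sequent.le_def.2 (by simp), by simp⟩
  simpa only [Finset.insert_eq_of_mem hΓ] using CutFreeDerivable.empL w h

theorem exists_ge_andL (hΓ : (w, .and A B) ∈ s.1.Γ) :
    ∃ t ≥ s, (w, A) ∈ t.1.Γ ∧ (w, B) ∈ t.1.Γ := by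
  refine ⟨⟨⟨s.1.G, insert (w, A) (insert (w, B) s.1.Γ), s.1.Δ⟩, fun h => s.2 ?_⟩,
    Sequent.le_def.2 (by grind), by simp⟩
  simpa only [Finset.insert_eq_of_mem hΓ] using CutFreeDerivable.andL w A B h

theorem exists_ge_andR (hΔ : (w, .and A B) ∈ s.1.Δ) :
    (∃ t ≥ s, (w, A) ∈ t.1.Δ) ∨ ∃ t ≥ s, (w, B) ∈ t.1.Δ := by
  by_cases hA : CutFreeDerivable Fr ⟨s.1.G, s.1.Γ, insert (w, A) s.1.Δ⟩
  · refine .inr ⟨⟨⟨s.1.G, s.1.Γ, insert (w, B) s.1.Δ⟩, fun hB => s.2 ?_⟩,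
      Sequent.le_def.2 (by simp), by simp⟩
    simpa only [Finset.insert_eq_of_mem hΔ] using CutFreeDerivable.andR w A B hA hB
  · exact .inl ⟨⟨_, hA⟩, Sequent.le_def.2 (by simp), by simp⟩

theorem exists_ge_impL (hΓ : (w, .imp A B) ∈ s.1.Γ) :
    (∃ t ≥ s, (w, A) ∈ t.1.Δ) ∨ ∃ t ≥ s, (w, B) ∈ t.1.Γ := by
  by_cases hA : CutFreeDerivable Fr ⟨s.1.G, s.1.Γ, insert (w, A) s.1.Δ⟩
  · refine .inr ⟨⟨⟨s.1.G, insert (w, B) s.1.Γ, s.1.Δ⟩, fun hB => s.2 ?_⟩,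
      Sequent.le_def.2 (by simp), by simp⟩
    simpa only [Finset.insert_eq_of_mem hΓ] using CutFreeDerivable.impL w A B hA hB
  · exact .inl ⟨⟨_, hA⟩, Sequent.le_def.2 (by simp), by simp⟩

theorem exists_ge_impR (hΔ : (w, .imp A B) ∈ s.1.Δ) :
    ∃ t ≥ s, (w, A) ∈ t.1.Γ ∧ (w, B) ∈ t.1.Δ := by
  refine ⟨⟨⟨s.1.G, insert (w, A) s.1.Γ, insert (w, B) s.1.Δ⟩, fun h => s.2 ?_⟩,
    Sequent.le_def.2 (by simp), by simp⟩
  simpa only [Finset.insert_eq_of_mem hΔ] using CutFreeDerivable.impR w A B h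

theorem exists_ge_starL (hΓ : (z, .star A B) ∈ s.1.Γ) :
    ∃ t ≥ s, ∃ x y, .rel x y z ∈ t.1.G ∧ (x, A) ∈ t.1.Γ ∧ (y, B) ∈ t.1.Γ := by
  obtain ⟨x, y, hxy, hx, hy⟩ := s.1.exists_fresh_pair
  have rule := CutFreeDerivable.starL (Fr := Fr) (G := s.1.G) (Γ := s.1.Γ) (Δ := s.1.Δ)
    z A B x y hxy
  simp only [Finset.insert_eq_of_mem hΓ] at rule
  refine ⟨⟨⟨insert (.rel (.var x) (.var y) z) s.1.G,
    insert (.var x, A) (insert (.var y, B) s.1.Γ), s.1.Δ⟩, fun h => s.2 (rule hx hy h)⟩,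
    Sequent.le_def.2 (by grind), .var x, .var y, by simp⟩

theorem exists_ge_starR (hΔ : (z, .star A B) ∈ s.1.Δ) (hG : .rel x y z' ∈ s.1.G)
    (hz : EqJudgment s.1.G z z') : (∃ t ≥ s, (x, A) ∈ t.1.Δ) ∨ ∃ t ≥ s, (y, B) ∈ t.1.Δ := by
  have rule := CutFreeDerivable.starR (Fr := Fr) (Γ := s.1.Γ) (Δ := s.1.Δ) x y z z' A B hz
  simp only [Finset.insert_eq_of_mem, hΔ, hG] at rule
  by_cases hA : CutFreeDerivable Fr ⟨s.1.G, s.1.Γ, insert (x, A) s.1.Δ⟩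
  · exact .inr ⟨⟨⟨s.1.G, s.1.Γ, insert (y, B) s.1.Δ⟩, fun hB => s.2 (rule hA hB)⟩,
      Sequent.le_def.2 (by simp), by simp⟩
  · exact .inl ⟨⟨_, hA⟩, Sequent.le_def.2 (by simp), by simp⟩

theorem exists_ge_wandL (hΓ : (z, .wand A B) ∈ s.1.Γ) (hG : .rel x z' y ∈ s.1.G)
    (hz : EqJudgment s.1.G z z') : (∃ t ≥ s, (x, A) ∈ t.1.Δ) ∨ ∃ t ≥ s, (y, B) ∈ t.1.Γ := by
  have rule := CutFreeDerivable.wandL (Fr := Fr) (Γ := s.1.Γ) (Δ := s.1.Δ) x y z z' A B hz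
  simp only [Finset.insert_eq_of_mem, hΓ, hG] at rule
  by_cases hA : CutFreeDerivable Fr ⟨s.1.G, s.1.Γ, insert (x, A) s.1.Δ⟩
  · exact .inr ⟨⟨⟨s.1.G, insert (y, B) s.1.Γ, s.1.Δ⟩, fun hB => s.2 (rule hA hB)⟩,
      Sequent.le_def.2 (by simp), by simp⟩
  · exact .inl ⟨⟨_, hA⟩, Sequent.le_def.2 (by simp), by simp⟩

theorem exists_ge_wandR (hΔ : (z, .wand A B) ∈ s.1.Δ) :
    ∃ t ≥ s, ∃ x y, .rel x z y ∈ t.1.G ∧ (x, A) ∈ t.1.Γ ∧ (y, B) ∈ t.1.Δ := by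
  obtain ⟨x, y, hxy, hx, hy⟩ := s.1.exists_fresh_pair
  have rule := CutFreeDerivable.wandR (Fr := Fr) (G := s.1.G) (Γ := s.1.Γ) (Δ := s.1.Δ)
    z A B x y hxy
  simp only [Finset.insert_eq_of_mem hΔ] at rule
  refine ⟨⟨⟨insert (.rel (.var x) z (.var y)) s.1.G,
    insert (.var x, A) s.1.Γ, insert (.var y, B) s.1.Δ⟩, fun h => s.2 (rule hx hy h)⟩,
    Sequent.le_def.2 (by simp), .var x, .var y, by simp⟩

variable (s x y) in
theorem exists_ge_em : (∃ t ≥ s, .eq x y ∈ t.1.G) ∨ ∃ t ≥ s, .neq x y ∈ t.1.G := by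
  by_cases h : CutFreeDerivable Fr ⟨insert (.eq x y) s.1.G, s.1.Γ, s.1.Δ⟩
  · exact .inr ⟨⟨⟨insert (.neq x y) s.1.G, s.1.Γ, s.1.Δ⟩, fun h' => s.2 (.em x y h h')⟩,
      Sequent.le_def.2 (by simp), by simp⟩
  · exact .inl ⟨⟨_, h⟩, Sequent.le_def.2 (by simp), by simp⟩

theorem exists_ge_struct {ax : FrameAxiom} (hax : ax ∈ Fr) {θ : Fin ax.m → Label}
    (hante : ∀ S ∈ ax.ante, S.subst θ ∈ s.1.G)
    (heqs : ∀ e ∈ ax.eqs, EqJudgment s.1.G (e.1.subst θ) (e.2.subst θ)) :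
    ∃ t ≥ s, ∃ τ : Fin ax.n → Label, ∀ T ∈ ax.concl, T.subst (Sum.elim θ τ) ∈ t.1.G := by
  obtain ⟨σ, hinj, hfresh, hθσ⟩ := s.1.exists_fresh_injective θ ax.n
  have hG : s.1.G ∪ (ax.ante.map (Atom.subst θ)).toFinset = s.1.G :=
    Finset.union_eq_left.2 fun r hr => by
      obtain ⟨S, hS, rfl⟩ := List.mem_map.1 (List.mem_toFinset.1 hr)
      exact hante S hS
  have rule := CutFreeDerivable.struct (G := s.1.G) (Γ := s.1.Γ) (Δ := s.1.Δ) ax θ σ hax hinj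
  rw [hG] at rule
  refine ⟨⟨_, fun h => s.2 (rule hfresh hθσ heqs h)⟩, Sequent.le_def.2 (by simp),
    fun j => .var (σ j), fun T hT => ?_⟩
  exact Finset.mem_union_right _ (List.mem_toFinset.2 (List.mem_map_of_mem hT))

end UnderivableSequent

/-! ### Fair chains and their limits -/

theorem exists_monotone_of_countable_demands {P ι : Type*} [Preorder P] [Countable ι] (p : P)
    (Q : ι → P → Prop) :
    ∃ u : ℕ → P, u 0 = p ∧ Monotone u ∧
      ∀ i, (∃ᶠ n in atTop, ∃ q ≥ u n, Q i q) → ∃ n, Q i (u n) := by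
  have := Encodable.ofCountable ι
  let D (i : ι) : Order.Cofinal P :=
    { carrier := {q | Q i q ∨ ∀ r ≥ q, ¬ Q i r}
      isCofinal := fun q => by
        by_cases! h : ∃ r ≥ q, Q i r
        · obtain ⟨r, hqr, hr⟩ := h
          exact ⟨r, .inl hr, hqr⟩
        · exact ⟨q, .inr h, le_rfl⟩ }
  refine ⟨Order.sequenceOfCofinals p D, rfl, Order.sequenceOfCofinals.monotone p D,
    fun i hi => ⟨_, (Order.sequenceOfCofinals.encode_mem p D i).resolve_right fun h => ?_⟩⟩
  obtain ⟨n, hn, q, hq, hQ⟩ := frequently_atTop.1 hi (Encodable.encode i + 1)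
  exact h q ((Order.sequenceOfCofinals.monotone p D hn).trans hq) hQ

/-- The events that a fair chain of sequents must not postpone forever: the occurrence of an atom
or of a labelled formula, and of some instance of the premise of `starL`, of `wandR` or of the
rule for a frame axiom. The formulae are drawn from `Φ`. -/
inductive Demand (Φ : Type*) where
  | atom (r : Atom ℕ)
  | left (w : Label) (A : Φ)
  | right (w : Label) (A : Φ)
  | star (z : Label) (A B : Φ)
  | wand (z : Label) (A B : Φ)
  | struct (ax : FrameAxiom) (θ : Fin ax.m → Label)
  deriving Countable

/-- The demand `d` is met by a sequent. -/
def Demand.Met {S : Set (Formula Var)} : Demand S → Sequent Var → Prop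
  | .atom r, s => r ∈ s.G
  | .left w A, s => (w, A.1) ∈ s.Γ
  | .right w A, s => (w, A.1) ∈ s.Δ
  | .star z A B, s => ∃ x y, .rel x y z ∈ s.G ∧ (x, A.1) ∈ s.Γ ∧ (y, B.1) ∈ s.Γ
  | .wand z A B, s => ∃ x y, .rel x z y ∈ s.G ∧ (x, A.1) ∈ s.Γ ∧ (y, B.1) ∈ s.Δ
  | .struct ax θ, s => ∃ τ : Fin ax.n → Label, ∀ T ∈ ax.concl, T.subst (Sum.elim θ τ) ∈ s.G

/-- An increasing chain of underivable sequents that meets every demand with formulae in `S` that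
can be met by extending its members arbitrarily far along the chain. -/
structure IsFair (S : Set (Formula Var)) (u : ℕ → UnderivableSequent Var Fr) : Prop where
  monotone : Monotone u
  exists_met (d : Demand S) : (∃ᶠ n in atTop, ∃ t ≥ u n, d.Met t.1) → ∃ n, d.Met (u n).1

/-- The union of a chain of sequents, restricted to the formulae in `S`. -/
def limit (S : Set (Formula Var)) (u : ℕ → UnderivableSequent Var Fr) : LimitSequent Var where
  G := {r | ∃ n, r ∈ (u n).1.G}
  Γ := {f | f.2 ∈ S ∧ ∃ n, f ∈ (u n).1.Γ}
  Δ := {f | f.2 ∈ S ∧ ∃ n, f ∈ (u n).1.Δ}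

namespace IsFair

variable {S : Set (Formula Var)} {u : ℕ → UnderivableSequent Var Fr}

theorem eventually_mem_G (hu : IsFair S u) {r : Atom ℕ} (h : r ∈ (limit S u).G) :
    ∀ᶠ n in atTop, r ∈ (u n).1.G := by
  obtain ⟨n, hn⟩ := h
  exact (eventually_ge_atTop n).mono fun k hk => (hu.monotone hk).1 hn

theorem eventually_mem_Γ (hu : IsFair S u) {f : Label × Formula Var} (h : f ∈ (limit S u).Γ) :
    ∀ᶠ n in atTop, f ∈ (u n).1.Γ := by
  obtain ⟨-, n, hn⟩ := h
  exact (eventually_ge_atTop n).mono fun k hk => (hu.monotone hk).2.1 hn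

theorem eventually_mem_Δ (hu : IsFair S u) {f : Label × Formula Var} (h : f ∈ (limit S u).Δ) :
    ∀ᶠ n in atTop, f ∈ (u n).1.Δ := by
  obtain ⟨-, n, hn⟩ := h
  exact (eventually_ge_atTop n).mono fun k hk => (hu.monotone hk).2.2 hn

theorem eventually_eqJudgment (hu : IsFair S u) {x y : Label} (h : (limit S u).LabelEq x y) :
    ∀ᶠ n in atTop, EqJudgment (u n).1.G x y := by
  induction h with
  | rel x y h => exact (hu.eventually_mem_G h).mono fun _ h => .rel x y h
  | refl x => exact .of_forall fun _ => .refl x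
  | symm x y _ ih => exact ih.mono fun _ => .symm x y
  | trans x y z _ _ ihxy ihyz => filter_upwards [ihxy, ihyz] with _ using .trans x y z

theorem mem_G_of_frequently (hu : IsFair S u) {r : Atom ℕ}
    (h : ∃ᶠ n in atTop, ∃ t ≥ u n, r ∈ t.1.G) : r ∈ (limit S u).G :=
  hu.exists_met (.atom r) h

theorem mem_Γ_of_frequently (hu : IsFair S u) {w : Label} {A : Formula Var} (hA : A ∈ S)
    (h : ∃ᶠ n in atTop, ∃ t ≥ u n, (w, A) ∈ t.1.Γ) : (w, A) ∈ (limit S u).Γ :=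
  ⟨hA, hu.exists_met (.left w ⟨A, hA⟩) h⟩

theorem mem_Δ_of_frequently (hu : IsFair S u) {w : Label} {A : Formula Var} (hA : A ∈ S)
    (h : ∃ᶠ n in atTop, ∃ t ≥ u n, (w, A) ∈ t.1.Δ) : (w, A) ∈ (limit S u).Δ :=
  ⟨hA, hu.exists_met (.right w ⟨A, hA⟩) h⟩

open UnderivableSequent

theorem exists_rel_mem_of_star_mem_Γ (hu : IsFair S u) (hS : SubformulaClosed S) {z : Label}
    {A B : Formula Var} (h : (z, .star A B) ∈ (limit S u).Γ) :
    ∃ x y, .rel x y z ∈ (limit S u).G ∧ (x, A) ∈ (limit S u).Γ ∧ (y, B) ∈ (limit S u).Γ := by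
  obtain ⟨hA, hB⟩ := hS.star h.1
  obtain ⟨n, x, y, hr, hx, hy⟩ := hu.exists_met (.star z ⟨A, hA⟩ ⟨B, hB⟩)
    ((hu.eventually_mem_Γ h).frequently.mono fun _ => exists_ge_starL)
  exact ⟨x, y, ⟨n, hr⟩, ⟨hA, n, hx⟩, ⟨hB, n, hy⟩⟩

theorem exists_rel_mem_of_wand_mem_Δ (hu : IsFair S u) (hS : SubformulaClosed S) {z : Label}
    {A B : Formula Var} (h : (z, .wand A B) ∈ (limit S u).Δ) :
    ∃ x y, .rel x z y ∈ (limit S u).G ∧ (x, A) ∈ (limit S u).Γ ∧ (y, B) ∈ (limit S u).Δ := by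
  obtain ⟨hA, hB⟩ := hS.wand h.1
  obtain ⟨n, x, y, hr, hx, hy⟩ := hu.exists_met (.wand z ⟨A, hA⟩ ⟨B, hB⟩)
    ((hu.eventually_mem_Δ h).frequently.mono fun _ => exists_ge_wandR)
  exact ⟨x, y, ⟨n, hr⟩, ⟨hA, n, hx⟩, ⟨hB, n, hy⟩⟩

theorem mem_Δ_or_mem_Δ_of_star_mem_Δ (hu : IsFair S u) (hS : SubformulaClosed S)
    {x y z z' : Label} {A B : Formula Var} (h : (z, .star A B) ∈ (limit S u).Δ)
    (hG : .rel x y z' ∈ (limit S u).G) (heq : (limit S u).LabelEq z z') :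
    (x, A) ∈ (limit S u).Δ ∨ (y, B) ∈ (limit S u).Δ := by
  have hbranch : ∀ᶠ n in atTop,
      (∃ t ≥ u n, (x, A) ∈ t.1.Δ) ∨ ∃ t ≥ u n, (y, B) ∈ t.1.Δ := by
    filter_upwards [hu.eventually_mem_Δ h, hu.eventually_mem_G hG, hu.eventually_eqJudgment heq]
      with _ using exists_ge_starR
  exact (frequently_or_distrib.1 hbranch.frequently).imp
    (hu.mem_Δ_of_frequently (hS.star h.1).1) (hu.mem_Δ_of_frequently (hS.star h.1).2)

theorem mem_Δ_or_mem_Γ_of_wand_mem_Γ (hu : IsFair S u) (hS : SubformulaClosed S)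
    {x y z z' : Label} {A B : Formula Var} (h : (z, .wand A B) ∈ (limit S u).Γ)
    (hG : .rel x z' y ∈ (limit S u).G) (heq : (limit S u).LabelEq z z') :
    (x, A) ∈ (limit S u).Δ ∨ (y, B) ∈ (limit S u).Γ := by
  have hbranch : ∀ᶠ n in atTop,
      (∃ t ≥ u n, (x, A) ∈ t.1.Δ) ∨ ∃ t ≥ u n, (y, B) ∈ t.1.Γ := by
    filter_upwards [hu.eventually_mem_Γ h, hu.eventually_mem_G hG, hu.eventually_eqJudgment heq]
      with _ using exists_ge_wandL
  exact (frequently_or_distrib.1 hbranch.frequently).imp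
    (hu.mem_Δ_of_frequently (hS.wand h.1).1) (hu.mem_Γ_of_frequently (hS.wand h.1).2)

theorem exists_concl_subst_mem (hu : IsFair S u) {ax : FrameAxiom} (hax : ax ∈ Fr)
    {θ : Fin ax.m → Label} (hante : ∀ T ∈ ax.ante, T.subst θ ∈ (limit S u).G)
    (heqs : ∀ e ∈ ax.eqs, (limit S u).LabelEq (e.1.subst θ) (e.2.subst θ)) :
    ∃ τ : Fin ax.n → Label, ∀ T ∈ ax.concl, T.subst (Sum.elim θ τ) ∈ (limit S u).G := by
  have hante' : ∀ᶠ n in atTop, ∀ T ∈ ax.ante, T.subst θ ∈ (u n).1.G :=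
    (eventually_all_finite ax.ante.finite_toSet).2 fun T hT => hu.eventually_mem_G (hante T hT)
  have heqs' : ∀ᶠ n in atTop, ∀ e ∈ ax.eqs, EqJudgment (u n).1.G (e.1.subst θ) (e.2.subst θ) :=
    (eventually_all_finite ax.eqs.finite_toSet).2 fun e he => hu.eventually_eqJudgment (heqs e he)
  obtain ⟨n, τ, hτ⟩ := hu.exists_met (.struct ax θ)
    ((hante'.and heqs').frequently.mono fun _ h => exists_ge_struct hax h.1 h.2)
  exact ⟨τ, fun T hT => ⟨n, hτ T hT⟩⟩

theorem isHintikka_limit (hu : IsFair S u) (hS : SubformulaClosed S) :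
    (limit S u).IsHintikka Fr where
  id hΓ hΔ heq := by
    obtain ⟨n, hΓ, hΔ, heq⟩ := ((hu.eventually_mem_Γ hΓ).and ((hu.eventually_mem_Δ hΔ).and
      (hu.eventually_eqJudgment heq))).exists
    exact not_eqJudgment_of_var hΓ hΔ heq
  botL h := bot_notMem h.2.choose_spec
  topR h := top_notMem h.2.choose_spec
  empL h := hu.mem_G_of_frequently
    ((hu.eventually_mem_Γ h).frequently.mono fun _ => exists_ge_empL)
  empR h heq := by
    obtain ⟨n, hΔ, heq⟩ := ((hu.eventually_mem_Δ h).and (hu.eventually_eqJudgment heq)).exists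
    exact not_eqJudgment_eps hΔ heq
  andL h := by
    have hex := (hu.eventually_mem_Γ h).frequently.mono fun _ => exists_ge_andL
    exact ⟨hu.mem_Γ_of_frequently (hS.and h.1).1 (hex.mono fun _ => by grind),
      hu.mem_Γ_of_frequently (hS.and h.1).2 (hex.mono fun _ => by grind)⟩
  andR h := (frequently_or_distrib.1
    ((hu.eventually_mem_Δ h).frequently.mono fun _ => exists_ge_andR)).imp
      (hu.mem_Δ_of_frequently (hS.and h.1).1) (hu.mem_Δ_of_frequently (hS.and h.1).2)
  impL h := (frequently_or_distrib.1
    ((hu.eventually_mem_Γ h).frequently.mono fun _ => exists_ge_impL)).imp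
      (hu.mem_Δ_of_frequently (hS.imp h.1).1) (hu.mem_Γ_of_frequently (hS.imp h.1).2)
  impR h := by
    have hex := (hu.eventually_mem_Δ h).frequently.mono fun _ => exists_ge_impR
    exact ⟨hu.mem_Γ_of_frequently (hS.imp h.1).1 (hex.mono fun _ => by grind),
      hu.mem_Δ_of_frequently (hS.imp h.1).2 (hex.mono fun _ => by grind)⟩
  starL := hu.exists_rel_mem_of_star_mem_Γ hS
  starR := hu.mem_Δ_or_mem_Δ_of_star_mem_Δ hS
  wandL := hu.mem_Δ_or_mem_Γ_of_wand_mem_Γ hS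
  wandR := hu.exists_rel_mem_of_wand_mem_Δ hS
  nEq h heq := by
    obtain ⟨n, hG, heq⟩ := ((hu.eventually_mem_G h).and (hu.eventually_eqJudgment heq)).exists
    exact not_eqJudgment_of_neq hG heq
  em x y := (frequently_or_distrib.1 (.of_forall fun n => exists_ge_em (u n) x y)).imp
    hu.mem_G_of_frequently hu.mem_G_of_frequently
  struct hax := hu.exists_concl_subst_mem hax

end IsFair

theorem UnderivableSequent.exists_isHintikka (s : UnderivableSequent Var Fr) :
    ∃ L : LimitSequent Var, L.IsHintikka Fr ∧ ↑s.1.G ⊆ L.G ∧ ↑s.1.Γ ⊆ L.Γ ∧ ↑s.1.Δ ⊆ L.Δ := by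
  obtain ⟨S, hsS, hcount, hS⟩ := exists_countable_subformulaClosed
    ((s.1.Γ ∪ s.1.Δ).image Prod.snd).countable_toSet
  have := hcount.to_subtype
  obtain ⟨u, rfl, hmono, hmet⟩ := exists_monotone_of_countable_demands s
    fun (d : Demand S) t => d.Met t.1
  refine ⟨limit S u, IsFair.isHintikka_limit ⟨hmono, hmet⟩ hS, fun r hr => ⟨0, hr⟩,
    fun f hf => ⟨hsS ?_, 0, hf⟩, fun f hf => ⟨hsS ?_, 0, hf⟩⟩
  · exact Finset.mem_image_of_mem _ (Finset.mem_union_left _ hf)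
  · exact Finset.mem_image_of_mem _ (Finset.mem_union_right _ hf)

end LSG

theorem mainTheorem1_general {Var : Type*} [DecidableEq Var] (Fr : Set LSG.FrameAxiom)
    (s : LSG.Sequent Var) (hs : ¬ LSG.CutFreeDerivable Fr s) :
    ∃ (M : LSG.KripkeModel.{_, 0} Var) (ρ : ℕ → M.World),
      (∀ ax ∈ Fr, M.toKripkeFrame.Satisfies ax) ∧
      (∀ r ∈ s.G, r.Holds M.toKripkeFrame ρ) ∧
      (∀ f ∈ s.Γ, M.Forces (f.1.eval M.toKripkeFrame ρ) f.2) ∧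
      ∀ f ∈ s.Δ, ¬ M.Forces (f.1.eval M.toKripkeFrame ρ) f.2 := by
  obtain ⟨L, hL, hG, hΓ, hΔ⟩ := LSG.UnderivableSequent.exists_isHintikka ⟨s, hs⟩
  have eval (x : LSG.Label) :
      x.eval L.canonicalModel.toKripkeFrame (L.world ∘ LSG.Term.var) = L.world x := by
    rw [L.eval_world_comp, LSG.Term.subst_var]
  refine ⟨L.canonicalModel, L.world ∘ LSG.Term.var, fun ax hax => hL.satisfies hax,
    fun r hr => hL.holds_of_subst_mem _ ?_, fun f hf => ?_, fun f hf => ?_⟩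
  · rw [LSG.Atom.subst_var]; exact hG hr
  · rw [eval]
    exact (hL.forces_and_not_forces f.2 f.1).1 (hΓ hf)
  · rw [eval]
    exact (hL.forces_and_not_forces f.2 f.1).2 (hΔ hf)

theorem mainTheorem1 {Var : Type*} [DecidableEq Var]
    (Fr : Set LSG.FrameAxiom) (hFr : Fr.Finite) (F : LSG.Formula Var)
    (w : LSG.Label) (hw : w ≠ LSG.Term.eps)
    (hF : ¬ LSG.CutFreeDerivable Fr ⟨∅, ∅, {(w, F)}⟩) :
    ∃ M : LSG.KripkeModel.{_, 0} Var,
      (∀ ax ∈ Fr, M.toKripkeFrame.Satisfies ax) ∧ ∃ h : M.World, ¬ M.Forces h F := by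
  obtain ⟨M, ρ, hM, -, -, hΔ⟩ := mainTheorem1_general Fr _ hF
  exact ⟨M, hM, _, hΔ (w, F) (Finset.mem_singleton_self _)⟩
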